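/- Let $R$ be an integral domain with field of fractions $Q$, and for an ideal $J$ of $R$ put $J^{-1}=\{x\in Q\mid xJ\subseteq R\}$; call $J$ invertible if $JJ^{-1}=R$. A commutative ring is perfect if every flat module over it is projective. Let $\mathcal I$ be a set of invertible ideals of $R$ such that $R/I$ is a perfect ring for every $I\in\mathcal I$, and let $\mathcal D_{\mathcal I}=\{M \mid M=IM\ \text{for all } I\in\mathcal I\}$ be the class of all $\mathcal I$-divisible $R$-modules. Then $\mathcal D_{\mathcal I}$ is closed under flat covers: whenever $M\in\mathcal D_{\mathcal I}$ and $h\colon F\to M$ is a flat cover (that is, $F$ is flat, every homomorphism from a flat $R$-module to $M$ factors through $h$, and every endomorphism $e$ of $F$ with $he=h$ is an automorphism), then $F\in\mathcal D_{\mathcal I}$. Moreover, for every $I\in\mathcal I$ and every flat $R$-module $F$, with $Q_I=\bigcup_{n\ge 0}(I^n)^{-1}\subseteq Q$, the module $F\otimes_R Q_I$ is flat and the canonical map $F\to F\otimes_R Q_I$, $x\mapsto x\otimes 1$, is a $\mathcal D_{\{I\}}$-preenvelope of $F$: the module $L = F\otimes_R Q_I$ satisfies $L=IL$, and every homomorphism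 from $F$ to an $R$-module $N$ with $N=IN$ factors through $F\to F\otimes_R Q_I$. -/

import Mathlib

open scoped TensorProduct nonZeroDivisors

universe u v w

/-- A class of `R`-modules (modules living in the universe `w`). -/
abbrev ModuleClass (R : Type u) [CommRing R] : Type (max u (w + 1)) :=
  ∀ (M : Type w) [AddCommGroup M] [Module R M], Prop

namespace ModuleClass

/-- The class of all flat `R`-modules. -/
def flat (R : Type u) [CommRing R] : ModuleClass.{u, w} R :=
  fun M _ _ => Module.Flat R M

/-- The class of all `𝓘`-divisible `R`-modules, that is, of all `M` with `M = I M` for every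
`I ∈ 𝓘`. -/
def divisible {R : Type u} [CommRing R] (𝓘 : Set (Ideal R)) : ModuleClass.{u, w} R :=
  fun M _ _ => ∀ I ∈ 𝓘, I • (⊤ : Submodule R M) = ⊤

/-- `f : A → M` is a `C`-precover of `M`: `A` belongs to `C`, and every map from a member of `C`
to `M` factors through `f`. -/
def IsPrecover {R : Type u} [CommRing R] (C : ModuleClass.{u, w} R)
    {A M : Type w} [AddCommGroup A] [Module R A] [AddCommGroup M] [Module R M]
    (f : A →ₗ[R] M) : Prop :=
  C A ∧ ∀ (A' : Type w) [AddCommGroup A'] [Module R A'], C A' →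
    ∀ g : A' →ₗ[R] M, ∃ h : A' →ₗ[R] A, f ∘ₗ h = g

/-- `f : A → M` is a `C`-cover of `M`: a `C`-precover such that every endomorphism `h` of `A`
with `f ∘ h = f` is an automorphism. -/
def IsCover {R : Type u} [CommRing R] (C : ModuleClass.{u, w} R)
    {A M : Type w} [AddCommGroup A] [Module R A] [AddCommGroup M] [Module R M]
    (f : A →ₗ[R] M) : Prop :=
  C.IsPrecover f ∧ ∀ h : A →ₗ[R] A, f ∘ₗ h = f → Function.Bijective h

/-- `f : M → A` is a `C`-preenvelope of `M`: `A` belongs to `C`, and every map from `M` to a member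
of `C` factors through `f`. -/
def IsPreenvelope {R : Type u} [CommRing R] (C : ModuleClass.{u, w} R)
    {M A : Type w} [AddCommGroup M] [Module R M] [AddCommGroup A] [Module R A]
    (f : M →ₗ[R] A) : Prop :=
  C A ∧ ∀ (A' : Type w) [AddCommGroup A'] [Module R A'], C A' →
    ∀ g : M →ₗ[R] A', ∃ h : A →ₗ[R] A', h ∘ₗ f = g

/-- `C` is closed under `𝓕`-covers: whenever `F → M` is an `𝓕`-cover of a member `M` of `C`,
then `F` belongs to `C`. -/
def ClosedUnderCovers {R : Type u} [CommRing R] (C 𝓕 : ModuleClass.{u, w} R) : Prop :=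
  ∀ (F M : Type w) [AddCommGroup F] [Module R F] [AddCommGroup M] [Module R M]
    (h : F →ₗ[R] M), 𝓕.IsCover h → C M → C F

end ModuleClass

/-- A commutative ring is perfect (in the sense of Bass) if every flat module over it is
projective. -/
def IsBassPerfect (S : Type u) [CommRing S] : Prop :=
  ∀ (M : Type w) [AddCommGroup M] [Module S M], Module.Flat S M → Module.Projective S M

namespace Ideal

/-- An ideal `I` of a domain with field of fractions `Q` is invertible if `I I⁻¹ = R`, where
`I⁻¹ = {x ∈ Q | x I ⊆ R}`. -/
def IsInvertibleIdeal {R : Type u} [CommRing R] [IsDomain R] (I : Ideal R) : Prop :=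
  (I : FractionalIdeal R⁰ (FractionRing R)) * (I : FractionalIdeal R⁰ (FractionRing R))⁻¹ = 1

/-- `Q_I = ⋃ₙ I⁻ⁿ`, where `I⁻ⁿ = (Iⁿ)⁻¹ = {x ∈ Q | x Iⁿ ⊆ R}`, as an `R`-submodule of the field
of fractions `Q`. -/
def unionInvPow {R : Type u} [CommRing R] [IsDomain R] (I : Ideal R) :
    Submodule R (FractionRing R) where
  carrier := {x | ∃ n : ℕ, ∀ a ∈ I ^ n, ∃ r : R, algebraMap R (FractionRing R) r = a • x}
  zero_mem' := ⟨0, fun _ _ => ⟨0, by simp⟩⟩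
  add_mem' := by
    rintro x y ⟨m, hm⟩ ⟨n, hn⟩
    refine ⟨max m n, fun a ha => ?_⟩
    obtain ⟨r, hr⟩ := hm a (Ideal.pow_le_pow_right (le_max_left m n) ha)
    obtain ⟨s, hs⟩ := hn a (Ideal.pow_le_pow_right (le_max_right m n) ha)
    exact ⟨r + s, by rw [map_add, hr, hs, smul_add]⟩
  smul_mem' := by
    rintro c x ⟨n, hn⟩
    refine ⟨n, fun a ha => ?_⟩
    obtain ⟨r, hr⟩ := hn a ha
    exact ⟨c * r, by rw [map_mul, hr, smul_comm a c x, Algebra.smul_def c]⟩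

theorem one_mem_unionInvPow {R : Type u} [CommRing R] [IsDomain R] (I : Ideal R) :
    (1 : FractionRing R) ∈ I.unionInvPow :=
  ⟨0, fun a _ => ⟨a, by rw [Algebra.smul_def, mul_one]⟩⟩

/-- The canonical map `F → F ⊗ Q_I`, `x ↦ x ⊗ 1`. -/
noncomputable def toTensorUnionInvPow {R : Type u} [CommRing R] [IsDomain R] (I : Ideal R)
    (F : Type w) [AddCommGroup F] [Module R F] : F →ₗ[R] F ⊗[R] I.unionInvPow :=
  (TensorProduct.mk R F I.unionInvPow).flip ⟨1, I.one_mem_unionInvPow⟩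

end Ideal

/-! Let `N = I N` and let `F` be flat. The module `F ⊗ Q_I` is the union of the flat submodules `F ⊗
I⁻ⁿ`, starting from a copy of `F`, and `I (F ⊗ I⁻⁽ⁿ⁺¹⁾) = F ⊗ I⁻ⁿ`. A map `F → N` is thus extended
step by step once maps `I G → N` extend to flat `G` (`exists_extend`). The obstruction to this is an
extension of `G` by the elements of `N` killed by `I`. It splits because `G` is flat and `G ⧸ I G`
is projective over the perfect ring `R ⧸ I`. For a flat cover `h : F → M`, the extension of `h` to
the flat module `F ⊗ Q_I` lifts back to `F`. The composite endomorphism of `F` is an automorphism,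
so `F` is a quotient of the `I`-divisible module `F ⊗ Q_I`. -/

/-! ### Splitting extensions modulo `I`. -/

section Extension

variable {R : Type*} [CommRing R] {I : Ideal R}

/-- A surjection onto a flat module `G` whose kernel is killed by `I` splits as soon as `G ⧸ I G` is
projective over `R ⧸ I`. -/
theorem LinearMap.exists_rightInverse_of_flat_of_projective_quotient
    {E G : Type*} [AddCommGroup E] [Module R E] [AddCommGroup G] [Module R G] [Module.Flat R G]
    [Module.Projective (R ⧸ I) (G ⧸ I • (⊤ : Submodule R G))]
    (α : E →ₗ[R] G) (hα : Function.Surjective α) (hker : I • LinearMap.ker α = ⊥) :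
    ∃ σ : G →ₗ[R] E, α ∘ₗ σ = LinearMap.id := by
  have hle : I • (⊤ : Submodule R E) ≤ (I • (⊤ : Submodule R G)).comap α := by
    rw [← Submodule.map_le_iff_le_comap, Submodule.map_smul'']
    exact Submodule.smul_mono le_rfl le_top
  have hsurj : Function.Surjective (algebraMap R (R ⧸ I)) := Ideal.Quotient.mk_surjective
  let β : (E ⧸ I • (⊤ : Submodule R E)) →ₗ[R] (G ⧸ I • (⊤ : Submodule R G)) :=
    Submodule.mapQ _ _ α hle
  let β' := β.extendScalarsOfSurjective hsurj
  have hβ : Function.Surjective β' := fun y => by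
    obtain ⟨g, rfl⟩ := Submodule.Quotient.mk_surjective _ y
    obtain ⟨e, rfl⟩ := hα g
    exact ⟨Submodule.Quotient.mk e, rfl⟩
  obtain ⟨s', hs'⟩ := Module.projective_lifting_property β' LinearMap.id hβ
  let s : (G ⧸ I • (⊤ : Submodule R G)) →ₗ[R] (E ⧸ I • (⊤ : Submodule R E)) :=
    s'.restrictScalars R
  have hs : ∀ y, β (s y) = y := fun y => LinearMap.congr_fun hs' y
  -- `E` is the pullback of `E ⧸ I E` and `G` over `G ⧸ I G`. Injectivity of `θ` is where flatness
  -- enters: `ker α ∩ I E = I ker α = 0`.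
  let θ : E →ₗ[R] (E ⧸ I • (⊤ : Submodule R E)) × G := (Submodule.mkQ _).prod α
  have hθ : Function.Injective θ := by
    refine (injective_iff_map_eq_zero θ).2 fun e he => ?_
    have h1 : e ∈ I • (⊤ : Submodule R E) :=
      (Submodule.Quotient.mk_eq_zero _).1 (congrArg Prod.fst he)
    have h2 : α e = 0 := congrArg Prod.snd he
    have h3 : e ∈ LinearMap.ker α ⊓ I • (⊤ : Submodule R E) := ⟨h2, h1⟩
    rw [α.ker_inf_smul_top_eq_smul_of_flat I hα, hker] at h3
    exact h3
  let τ : G →ₗ[R] (E ⧸ I • (⊤ : Submodule R E)) × G := (s ∘ₗ Submodule.mkQ _).prod LinearMap.id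
  have hτ : ∀ g, τ g ∈ LinearMap.range θ := fun g => by
    obtain ⟨e, he⟩ := Submodule.Quotient.mk_surjective _ (s (Submodule.Quotient.mk g))
    -- A lift `e` of the class `s ḡ` maps to `g` only modulo `I G = α (I E)`; subtracting an element
    -- of `I E` corrects this without changing the class.
    have h1 : α e - g ∈ (I • (⊤ : Submodule R E)).map α := by
      rw [Submodule.map_smul'', Submodule.map_top, LinearMap.range_eq_top.2 hα,
        ← Submodule.Quotient.eq]
      exact (congrArg β he).trans (hs _)
    obtain ⟨i, hi, hi'⟩ := h1
    refine ⟨e - i, Prod.ext ?_ ?_⟩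
    · change Submodule.Quotient.mk (e - i) = s (Submodule.Quotient.mk g)
      rw [← he, Submodule.Quotient.eq]
      simpa using hi
    · change α (e - i) = g
      rw [map_sub, hi']; abel
  refine ⟨(LinearEquiv.ofInjective θ hθ).symm.toLinearMap ∘ₗ τ.codRestrict _ hτ, ?_⟩
  ext g
  have h := congrArg Subtype.val ((LinearEquiv.ofInjective θ hθ).apply_symm_apply ⟨τ g, hτ g⟩)
  exact congrArg Prod.snd h

theorem IsBassPerfect.projective_quotient {R : Type u} [CommRing R] {I : Ideal R}
    (hperf : IsBassPerfect.{u, w} (R ⧸ I)) (G : Type w) [AddCommGroup G] [Module R G]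
    [Module.Flat R G] : Module.Projective (R ⧸ I) (G ⧸ I • (⊤ : Submodule R G)) :=
  hperf _ <| Module.Flat.of_linearEquiv
    ((TensorProduct.quotTensorEquivQuotSMul G I).extendScalarsOfSurjective
      Ideal.Quotient.mk_surjective).symm

end Extension

/-! ### Inverses of invertible ideals and their flatness. -/

namespace Ideal

variable {R : Type u} [CommRing R] {I J : Ideal R}

/-- `J⁻¹ = {x ∈ Q | x J ⊆ R}` as a submodule of the field of fractions `Q`. -/
def invSubmodule (J : Ideal R) : Submodule R (FractionRing R) where
  carrier := {x | ∀ a ∈ J, ∃ r : R, algebraMap R (FractionRing R) r = a • x}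
  zero_mem' := fun _ _ => ⟨0, by simp⟩
  add_mem' := by
    intro x y hx hy a ha
    obtain ⟨r, hr⟩ := hx a ha
    obtain ⟨s, hs⟩ := hy a ha
    exact ⟨r + s, by rw [map_add, hr, hs, smul_add]⟩
  smul_mem' := by
    intro c x hx a ha
    obtain ⟨r, hr⟩ := hx a ha
    exact ⟨c * r, by rw [map_mul, hr, smul_comm a c x, Algebra.smul_def c]⟩

theorem invSubmodule_anti (h : I ≤ J) : J.invSubmodule ≤ I.invSubmodule :=
  fun _ hx a ha => hx a (h ha)

theorem mul_mem_invSubmodule {x y : FractionRing R} (hx : x ∈ I.invSubmodule)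
    (hy : y ∈ J.invSubmodule) : x * y ∈ (I * J).invSubmodule := by
  intro c hc
  induction hc using Submodule.mul_induction_on' with
  | mem_mul_mem a ha b hb =>
    obtain ⟨r, hr⟩ := hx a ha
    obtain ⟨s, hs⟩ := hy b hb
    exact ⟨r * s, by rw [map_mul, hr, hs, smul_mul_smul_comm]⟩
  | add c _ d _ hc hd =>
    obtain ⟨r, hr⟩ := hc
    obtain ⟨s, hs⟩ := hd
    exact ⟨r + s, by rw [map_add, hr, hs, add_smul]⟩

variable [IsDomain R]

theorem mem_unionInvPow {x : FractionRing R} :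
    x ∈ I.unionInvPow ↔ ∃ n, x ∈ (I ^ n).invSubmodule :=
  Iff.rfl

theorem invSubmodule_pow_le_unionInvPow (I : Ideal R) (n : ℕ) :
    (I ^ n).invSubmodule ≤ I.unionInvPow :=
  fun _ hx => ⟨n, hx⟩

theorem IsInvertibleIdeal.pow (h : I.IsInvertibleIdeal) (n : ℕ) : (I ^ n).IsInvertibleIdeal := by
  unfold IsInvertibleIdeal at *
  rw [FractionalIdeal.mul_inv_cancel_iff]
  exact ⟨_, by rw [FractionalIdeal.coeIdeal_pow, ← mul_pow, h, one_pow]⟩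

/-- An invertible ideal has a dual basis. -/
theorem IsInvertibleIdeal.exists_dualBasis (h : I.IsInvertibleIdeal) :
    ∃ (k : ℕ) (a : Fin k → R) (b : Fin k → FractionRing R), (∀ i, a i ∈ I) ∧
      (∀ i, b i ∈ I.invSubmodule) ∧ ∑ i, a i • b i = 1 := by
  have h0 : (I : FractionalIdeal R⁰ (FractionRing R)) ≠ 0 := by
    intro h0
    rw [IsInvertibleIdeal, h0, zero_mul] at h
    exact zero_ne_one h
  have h1 : (1 : FractionRing R) ∈ (I : FractionalIdeal R⁰ (FractionRing R)) *
      (I : FractionalIdeal R⁰ (FractionRing R))⁻¹ := by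
    rw [show _ = _ from h]
    exact FractionalIdeal.one_mem_one _
  refine FractionalIdeal.mul_induction_on h1 (fun x hx y hy => ?_) fun x y hx hy => ?_
  · obtain ⟨a, ha, rfl⟩ := (FractionalIdeal.mem_coeIdeal _).1 hx
    refine ⟨1, fun _ => a, fun _ => y, fun _ => ha, fun _ c hc => ?_, by simp [Algebra.smul_def]⟩
    obtain ⟨r, hr⟩ := (FractionalIdeal.mem_one_iff _).1 <|
      (FractionalIdeal.mem_inv_iff h0).1 hy _ (FractionalIdeal.mem_coeIdeal_of_mem _ hc)
    exact ⟨r, by rw [hr, Algebra.smul_def, mul_comm]⟩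
  · obtain ⟨k, a, b, ha, hb, rfl⟩ := hx
    obtain ⟨l, c, d, hc, hd, rfl⟩ := hy
    refine ⟨k + l, Fin.append a c, Fin.append b d, fun i => ?_, fun i => ?_, ?_⟩
    · exact Fin.addCases (by simpa using ha) (by simpa using hc) i
    · exact Fin.addCases (by simpa using hb) (by simpa using hd) i
    · simp [Fin.sum_univ_add]

/-- Equational criterion: a dual basis `a`, `b` of `J` gives `x i = ∑ j, (a j * x i) • b j` with
coefficients in `R`, and multiplying a relation among the `x i` by `a j` gives the same relation
among these coefficients. -/
theorem IsInvertibleIdeal.flat_of_le {T : Submodule R (FractionRing R)}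
    (hT : ∀ (l : ℕ) (x : Fin l → T), ∃ J : Ideal R, J.IsInvertibleIdeal ∧
      J.invSubmodule ≤ T ∧ ∀ i, (x i : FractionRing R) ∈ J.invSubmodule) : Module.Flat R T := by
  refine Module.Flat.of_forall_isTrivialRelation fun {l f x} hfx => ?_
  obtain ⟨J, hJ, hJT, hx⟩ := hT l x
  obtain ⟨k, a, b, ha, hb, hab⟩ := hJ.exists_dualBasis
  choose r hr using fun i j => hx i (a j) (ha j)
  refine ⟨k, r, fun j => ⟨b j, hJT (hb j)⟩, fun i => ?_, fun j => ?_⟩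
  · ext
    rw [Submodule.coe_sum]
    simp only [Submodule.coe_smul, Algebra.smul_def, hr]
    simp only [Algebra.smul_def] at hab
    calc (x i : FractionRing R) = (x i : FractionRing R) * 1 := (mul_one _).symm
      _ = _ := by
        rw [← hab, Finset.mul_sum]
        exact Finset.sum_congr rfl fun j _ => by ring
  · apply FaithfulSMul.algebraMap_injective R (FractionRing R)
    have h := congrArg (fun t : T => a j • (t : FractionRing R)) hfx
    simp only [Submodule.coe_sum, Submodule.coe_smul, Submodule.coe_zero, smul_zero,
      Finset.smul_sum] at h
    rw [map_zero, ← h, map_sum]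
    refine Finset.sum_congr rfl fun i _ => ?_
    rw [map_mul, hr, smul_comm (a j), Algebra.smul_def (f i)]

theorem IsInvertibleIdeal.flat_invSubmodule (h : I.IsInvertibleIdeal) :
    Module.Flat R I.invSubmodule :=
  flat_of_le fun _ x => ⟨I, h, le_rfl, fun i => (x i).2⟩

theorem IsInvertibleIdeal.flat_unionInvPow (h : I.IsInvertibleIdeal) :
    Module.Flat R I.unionInvPow := by
  refine flat_of_le fun l x => ?_
  choose n hn using fun i => mem_unionInvPow.1 (x i).2
  exact ⟨I ^ Finset.univ.sup n, h.pow _, invSubmodule_pow_le_unionInvPow I _, fun i =>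
    invSubmodule_anti (Ideal.pow_le_pow_right (Finset.le_sup (Finset.mem_univ i))) (hn i)⟩

/-! ### Extending homomorphisms from `I G` to `G`. -/

/-- If `N = I N` with `I` invertible, then `N → Hom(I, N)` is surjective. -/
theorem IsInvertibleIdeal.exists_smul_eq (h : I.IsInvertibleIdeal) {N : Type*} [AddCommGroup N]
    [Module R N] (hN : I • (⊤ : Submodule R N) = ⊤) (ψ : I →ₗ[R] N) :
    ∃ n : N, ∀ a : I, ψ a = (a : R) • n := by
  -- The element `n` plays the role of `b m`: if `m = ∑ cᵢ nᵢ` with `cᵢ ∈ I`, take `n = ∑ (b cᵢ)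
  -- nᵢ`. The required element for `ψ` is then `∑ bⱼ ψ(aⱼ)`.
  have key : ∀ b ∈ I.invSubmodule, ∀ m : N, ∃ n : N, ∀ a ∈ I, ∀ r : R,
      algebraMap R (FractionRing R) r = a • b → r • m = a • n := by
    intro b hb m
    have hm : m ∈ I • (⊤ : Submodule R N) := by rw [hN]; exact Submodule.mem_top
    induction hm using Submodule.smul_induction_on' with
    | smul c hc n _ =>
      obtain ⟨s, hs⟩ := hb c hc
      refine ⟨s • n, fun a _ r hr => ?_⟩
      have : r * c = a * s := by
        apply FaithfulSMul.algebraMap_injective R (FractionRing R)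
        rw [map_mul, map_mul, hr, hs, Algebra.smul_def, Algebra.smul_def]
        ring
      rw [← mul_smul, ← mul_smul, this]
    | add m _ m' _ hm hm' =>
      obtain ⟨n, hn⟩ := hm
      obtain ⟨n', hn'⟩ := hm'
      exact ⟨n + n', fun a ha r hr => by rw [smul_add, smul_add, hn a ha r hr, hn' a ha r hr]⟩
  obtain ⟨k, a, b, ha, hb, hab⟩ := h.exists_dualBasis
  choose n hn using fun j => key (b j) (hb j) (ψ ⟨a j, ha j⟩)
  refine ⟨∑ j, n j, fun c => ?_⟩
  choose r hr using fun j => hb j c c.2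
  have hc : c = ∑ j, r j • (⟨a j, ha j⟩ : I) := by
    ext
    apply FaithfulSMul.algebraMap_injective R (FractionRing R)
    simp only [Submodule.coe_sum, Submodule.coe_smul, smul_eq_mul, map_sum, map_mul, hr]
    simp only [Algebra.smul_def] at hab ⊢
    calc algebraMap R (FractionRing R) c = algebraMap R (FractionRing R) c * 1 := (mul_one _).symm
      _ = _ := by
        rw [← hab, Finset.mul_sum]
        exact Finset.sum_congr rfl fun j _ => by ring
  conv_lhs => rw [hc]
  rw [map_sum, Finset.smul_sum]
  exact Finset.sum_congr rfl fun j _ => by rw [map_smul, hn j c c.2 (r j) (hr j)]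

/-- Homomorphisms from `I G` to an `I`-divisible module extend to `G` if `G` is flat. -/
theorem IsInvertibleIdeal.exists_extend (h : I.IsInvertibleIdeal) {G N : Type*} [AddCommGroup G]
    [Module R G] [Module.Flat R G] [Module.Projective (R ⧸ I) (G ⧸ I • (⊤ : Submodule R G))]
    [AddCommGroup N] [Module R N] (hN : I • (⊤ : Submodule R N) = ⊤)
    (f : (I • (⊤ : Submodule R G) : Submodule R G) →ₗ[R] N) :
    ∃ g : G →ₗ[R] N, ∀ x : (I • (⊤ : Submodule R G) : Submodule R G), g x = f x := by
  let ι (a : I) (x : G) : (I • (⊤ : Submodule R G) : Submodule R G) :=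
    ⟨(a : R) • x, Submodule.smul_mem_smul a.2 Submodule.mem_top⟩
  have ι_add (a : I) (x y : G) : ι a (x + y) = ι a x + ι a y := Subtype.ext (smul_add _ _ _)
  have ι_smul (a : I) (c : R) (x : G) : ι a (c • x) = c • ι a x := Subtype.ext (smul_comm _ _ _)
  -- The pairs `(x, n)` for which `n` is an admissible value at `x` of an extension of `f`. A linear
  -- section of `E → G` is exactly such an extension.
  let E : Submodule R (G × N) :=
    { carrier := {p | ∀ a : I, f (ι a p.1) = (a : R) • p.2}
      zero_mem' := fun a => by
        have : ι a 0 = 0 := Subtype.ext (smul_zero _)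
        simp [this]
      add_mem' := fun {p q} hp hq a => by
        rw [Prod.fst_add, Prod.snd_add, ι_add, map_add, smul_add, hp a, hq a]
      smul_mem' := fun c p hp a => by
        rw [Prod.smul_fst, Prod.smul_snd, ι_smul, map_smul, hp a, smul_comm] }
  let α : E →ₗ[R] G := LinearMap.fst R G N ∘ₗ E.subtype
  have hα : Function.Surjective α := fun x => by
    let ψ : I →ₗ[R] N :=
      { toFun := fun a => f (ι a x)
        map_add' := fun a b => by
          rw [← map_add]; exact congrArg f (Subtype.ext (add_smul _ _ _))
        map_smul' := fun c a => by
          rw [RingHom.id_apply, ← map_smul]; exact congrArg f (Subtype.ext (mul_smul _ _ _)) }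
    obtain ⟨n, hn⟩ := h.exists_smul_eq hN ψ
    exact ⟨⟨(x, n), hn⟩, rfl⟩
  have hker : I • LinearMap.ker α = ⊥ := by
    rw [eq_bot_iff, Submodule.smul_le]
    intro a ha e he
    rw [Submodule.mem_bot]
    have h1 : e.1.1 = 0 := he
    have h2 := e.2 ⟨a, ha⟩
    have h3 : ι ⟨a, ha⟩ e.1.1 = 0 := Subtype.ext (by simp [ι, h1])
    rw [h3, map_zero] at h2
    exact Subtype.ext (Prod.ext (by simp [h1]) h2.symm)
  obtain ⟨σ, hσ⟩ := α.exists_rightInverse_of_flat_of_projective_quotient (I := I) hα hker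
  have hσ' : ∀ x, (σ x).1.1 = x := fun x => LinearMap.congr_fun hσ x
  refine ⟨LinearMap.snd R G N ∘ₗ E.subtype ∘ₗ σ, fun x => ?_⟩
  obtain ⟨x, hx⟩ := x
  induction hx using Submodule.smul_induction_on' with
  | smul a ha x _ =>
    have := (σ x).2 ⟨a, ha⟩
    rw [hσ'] at this
    rw [map_smul]
    exact this.symm
  | add x hx y hy ihx ihy =>
    rw [map_add, ihx, ihy, ← map_add]
    rfl

/-- Partial maps on a fixed `L` make successive extensions comparable, so that a chain of them can
be glued. -/
theorem IsInvertibleIdeal.exists_extend_linearPMap (h : I.IsInvertibleIdeal) {L N : Type w}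
    [AddCommGroup L] [Module R L] [AddCommGroup N] [Module R N]
    (hperf : IsBassPerfect.{u, w} (R ⧸ I)) (hN : I • (⊤ : Submodule R N) = ⊤) {A B : Submodule R L}
    [Module.Flat R B] (hAB : I • B = A) (f : L →ₗ.[R] N) (hf : f.domain = A) :
    ∃ g : L →ₗ.[R] N, g.domain = B ∧ f ≤ g := by
  have := hperf.projective_quotient B
  have hmem : ∀ x : (I • (⊤ : Submodule R B) : Submodule R B), (x : L) ∈ f.domain := fun x => by
    rw [hf, ← hAB]
    exact (Submodule.mem_smul_top_iff I B x).1 x.2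
  obtain ⟨g, hg⟩ := h.exists_extend hN
    (f.toFun ∘ₗ (B.subtype ∘ₗ Submodule.subtype _).codRestrict f.domain hmem)
  have hle : f.domain ≤ B := by
    rw [hf, ← hAB]
    exact Submodule.smul_le_right
  refine ⟨⟨B, g⟩, rfl, hle, fun x y hxy => ?_⟩
  have hy : y ∈ I • (⊤ : Submodule R B) := by
    rw [Submodule.mem_smul_top_iff, hAB, ← hf, ← hxy]
    exact x.2
  refine Eq.trans ?_ (hg ⟨y, hy⟩).symm
  exact congrArg f (Subtype.ext hxy)

/-! ### The filtration of `F ⊗ Q_I` by the images of `F ⊗ I⁻ⁿ`. -/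

section Tensor

variable (I) (F : Type v) [AddCommGroup F] [Module R F]

/-- The image of `F ⊗ I⁻ⁿ` in `F ⊗ Q_I`. -/
noncomputable def tensorInvPow (n : ℕ) : Submodule R (F ⊗[R] I.unionInvPow) :=
  LinearMap.range ((Submodule.inclusion (invSubmodule_pow_le_unionInvPow I n)).lTensor F)

variable {I F}

theorem tmul_mem_tensorInvPow {n : ℕ} (x : F) {q : FractionRing R}
    (hq : q ∈ (I ^ n).invSubmodule) :
    x ⊗ₜ[R] (⟨q, n, hq⟩ : I.unionInvPow) ∈ I.tensorInvPow F n :=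
  ⟨x ⊗ₜ ⟨q, hq⟩, rfl⟩

theorem tensorInvPow_le_iff {n : ℕ} {S : Submodule R (F ⊗[R] I.unionInvPow)} :
    I.tensorInvPow F n ≤ S ↔ ∀ (x : F) (q : FractionRing R) (hq : q ∈ (I ^ n).invSubmodule),
      x ⊗ₜ[R] (⟨q, n, hq⟩ : I.unionInvPow) ∈ S := by
  refine ⟨fun h x q hq => h (tmul_mem_tensorInvPow x hq), ?_⟩
  rintro h _ ⟨t, rfl⟩
  induction t with
  | zero => simp
  | tmul x q => exact h x q.1 q.2
  | add t t' ht ht' => rw [map_add]; exact add_mem ht ht'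

theorem exists_mem_tensorInvPow (t : F ⊗[R] I.unionInvPow) : ∃ n, t ∈ I.tensorInvPow F n := by
  have mono : ∀ {m n : ℕ}, m ≤ n → I.tensorInvPow F m ≤ I.tensorInvPow F n := fun hmn =>
    tensorInvPow_le_iff.2 fun x q hq =>
      tmul_mem_tensorInvPow x (invSubmodule_anti (Ideal.pow_le_pow_right hmn) hq)
  induction t with
  | zero => exact ⟨0, zero_mem _⟩
  | tmul x q =>
    obtain ⟨q, n, hq⟩ := q
    exact ⟨n, tmul_mem_tensorInvPow x hq⟩
  | add t t' ht ht' =>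
    obtain ⟨m, hm⟩ := ht
    obtain ⟨n, hn⟩ := ht'
    exact ⟨max m n, add_mem (mono (le_max_left _ _) hm) (mono (le_max_right _ _) hn)⟩

theorem tensorInvPow_zero : I.tensorInvPow F 0 = LinearMap.range (I.toTensorUnionInvPow F) := by
  apply le_antisymm
  · refine tensorInvPow_le_iff.2 fun x q hq => ?_
    obtain ⟨r, hr⟩ := hq 1 (by simp)
    rw [one_smul] at hr
    refine ⟨r • x, ?_⟩
    change (r • x) ⊗ₜ[R] (⟨1, I.one_mem_unionInvPow⟩ : I.unionInvPow) = _
    rw [TensorProduct.smul_tmul]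
    exact congrArg _ (Subtype.ext (by simp [Algebra.smul_def, hr]))
  · rintro _ ⟨x, rfl⟩
    exact tmul_mem_tensorInvPow x (n := 0) fun a _ => ⟨a, by rw [Algebra.smul_def, mul_one]⟩

/-- This comes from `I I⁻⁽ⁿ⁺¹⁾ = I⁻ⁿ`; for the harder inclusion a dual basis gives `q = ∑ j, a j •
(q * b j)`. -/
theorem IsInvertibleIdeal.smul_tensorInvPow_succ (h : I.IsInvertibleIdeal) (n : ℕ) :
    I • I.tensorInvPow F (n + 1) = I.tensorInvPow F n := by
  apply le_antisymm
  · rw [Submodule.smul_le]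
    intro a ha t ht
    suffices I.tensorInvPow F (n + 1) ≤
        (I.tensorInvPow F n).comap (LinearMap.lsmul R (F ⊗[R] I.unionInvPow) a) from this ht
    refine tensorInvPow_le_iff.2 fun x q hq => ?_
    rw [Submodule.mem_comap, LinearMap.lsmul_apply, ← TensorProduct.tmul_smul]
    refine tmul_mem_tensorInvPow x (q := a • q) fun c hc => ?_
    obtain ⟨r, hr⟩ := hq (c * a) (by rw [pow_succ]; exact Ideal.mul_mem_mul hc ha)
    exact ⟨r, by rw [hr, mul_smul]⟩
  · refine tensorInvPow_le_iff.2 fun x q hq => ?_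
    obtain ⟨k, a, b, ha, hb, hab⟩ := h.exists_dualBasis
    have hbq : ∀ j, q * b j ∈ (I ^ (n + 1)).invSubmodule := fun j => by
      rw [pow_succ]; exact mul_mem_invSubmodule hq (hb j)
    have : (⟨q, n, hq⟩ : I.unionInvPow) =
        ∑ j, a j • (⟨q * b j, n + 1, hbq j⟩ : I.unionInvPow) := by
      ext
      simp only [Submodule.coe_sum, Submodule.coe_smul]
      calc q = q * ∑ j, a j • b j := by rw [hab, mul_one]
        _ = _ := by
          rw [Finset.mul_sum]
          exact Finset.sum_congr rfl fun j _ => mul_smul_comm _ _ _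
    rw [this, TensorProduct.tmul_sum]
    refine Submodule.sum_mem _ fun j _ => ?_
    rw [TensorProduct.tmul_smul]
    exact Submodule.smul_mem_smul (ha j) (tmul_mem_tensorInvPow x (hbq j))

theorem IsInvertibleIdeal.smul_top_tensor_unionInvPow (h : I.IsInvertibleIdeal) :
    I • (⊤ : Submodule R (F ⊗[R] I.unionInvPow)) = ⊤ := by
  refine eq_top_iff.2 fun t _ => ?_
  obtain ⟨n, hn⟩ := exists_mem_tensorInvPow t
  rw [← h.smul_tensorInvPow_succ] at hn
  exact Submodule.smul_mono le_rfl le_top hn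

theorem IsInvertibleIdeal.flat_tensorInvPow (h : I.IsInvertibleIdeal) [Module.Flat R F] (n : ℕ) :
    Module.Flat R (I.tensorInvPow F n) := by
  have := (h.pow n).flat_invSubmodule
  exact Module.Flat.of_linearEquiv (LinearEquiv.ofInjective _
    (Module.Flat.lTensor_preserves_injective_linearMap (M := F) _
      (Submodule.inclusion_injective (invSubmodule_pow_le_unionInvPow I n)))).symm

/-- The map is `R → Q_I` tensored with the flat module `F`. -/
theorem toTensorUnionInvPow_injective [Module.Flat R F] :
    Function.Injective (I.toTensorUnionInvPow F) := by
  let j : R →ₗ[R] I.unionInvPow := LinearMap.toSpanSingleton R _ ⟨1, I.one_mem_unionInvPow⟩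
  have hj : Function.Injective j := fun r s hrs => by
    apply FaithfulSMul.algebraMap_injective R (FractionRing R)
    simpa [j, Algebra.smul_def] using congrArg Subtype.val hrs
  have h := Module.Flat.lTensor_preserves_injective_linearMap (M := F) j hj
  have : I.toTensorUnionInvPow F = j.lTensor F ∘ₗ (TensorProduct.rid R F).symm.toLinearMap := by
    ext x
    simp [toTensorUnionInvPow, j]
  rw [this]
  exact h.comp (TensorProduct.rid R F).symm.injective

end Tensor

/-! ### The preenvelope property and the main theorem. -/

/-- Homomorphisms from a flat module `F` to an `I`-divisible module factor through
`F → F ⊗ Q_I`. -/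
theorem IsInvertibleIdeal.exists_comp_toTensorUnionInvPow (h : I.IsInvertibleIdeal)
    (hperf : IsBassPerfect.{u, max u v} (R ⧸ I)) {F N : Type (max u v)} [AddCommGroup F]
    [Module R F] [Module.Flat R F] [AddCommGroup N] [Module R N]
    (hN : I • (⊤ : Submodule R N) = ⊤) (g : F →ₗ[R] N) :
    ∃ g' : F ⊗[R] I.unionInvPow →ₗ[R] N, g' ∘ₗ I.toTensorUnionInvPow F = g := by
  let e := LinearEquiv.ofInjective _ (toTensorUnionInvPow_injective (I := I) (F := F))
  -- This is `g` transported to the image of `F`, the bottom layer of the filtration.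
  let f₀ : F ⊗[R] I.unionInvPow →ₗ.[R] N := ⟨_, g ∘ₗ e.symm.toLinearMap⟩
  have step : ∀ n (f : {f : F ⊗[R] I.unionInvPow →ₗ.[R] N // f.domain = I.tensorInvPow F n}),
      ∃ f' : {f' : F ⊗[R] I.unionInvPow →ₗ.[R] N // f'.domain = I.tensorInvPow F (n + 1)},
        f.1 ≤ f'.1 := fun n f => by
    have := h.flat_tensorInvPow (F := F) (n + 1)
    obtain ⟨f', hf', hle⟩ :=
      h.exists_extend_linearPMap hperf hN (h.smul_tensorInvPow_succ (F := F) n) f.1 f.2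
    exact ⟨⟨f', hf'⟩, hle⟩
  choose next hnext using step
  let s : ∀ n, {f : F ⊗[R] I.unionInvPow →ₗ.[R] N // f.domain = I.tensorInvPow F n} :=
    fun n => Nat.rec ⟨f₀, tensorInvPow_zero.symm⟩ next n
  have hs : Monotone fun n => (s n).1 := monotone_nat_of_le_succ fun n => hnext n (s n)
  have hdir : DirectedOn (· ≤ ·) (Set.range fun n => (s n).1) :=
    directedOn_range.2 hs.directed_le
  have hdom : ∀ t, t ∈ (LinearPMap.sSup _ hdir).domain := fun t => by
    obtain ⟨n, hn⟩ := exists_mem_tensorInvPow t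
    exact (LinearPMap.le_sSup hdir ⟨n, rfl⟩).1 ((s n).2.symm ▸ hn)
  refine ⟨(LinearPMap.sSup _ hdir).toFun ∘ₗ LinearMap.id.codRestrict _ hdom, ?_⟩
  ext x
  have h0 : f₀ ≤ LinearPMap.sSup _ hdir := LinearPMap.le_sSup hdir ⟨0, rfl⟩
  have h1 := h0.2 (x := e x) (y := ⟨_, hdom (e x)⟩) rfl
  refine h1.symm.trans ?_
  change g (e.symm (e x)) = g x
  rw [e.symm_apply_apply]

end Ideal

theorem proposition2p10 {R : Type u} [CommRing R] [IsDomain R] (𝓘 : Set (Ideal R))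
    (hinv : ∀ I ∈ 𝓘, I.IsInvertibleIdeal)
    (hperf : ∀ I ∈ 𝓘, IsBassPerfect.{u, max u v} (R ⧸ I)) :
    (ModuleClass.divisible.{u, max u v} 𝓘).ClosedUnderCovers (ModuleClass.flat R) ∧
    ∀ I ∈ 𝓘, ∀ (F : Type (max u v)) [AddCommGroup F] [Module R F], Module.Flat R F →
      Module.Flat R (F ⊗[R] I.unionInvPow) ∧
      (ModuleClass.divisible.{u, max u v} {I}).IsPreenvelope (I.toTensorUnionInvPow F) := by
  constructor
  · intro F M _ _ _ _ h hcover hM I hI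
    have hF : Module.Flat R F := hcover.1.1
    have := (hinv I hI).flat_unionInvPow
    obtain ⟨h', hh'⟩ :=
      (hinv I hI).exists_comp_toTensorUnionInvPow (hperf I hI) (hM I hI) h
    obtain ⟨k, hk⟩ := hcover.1.2 (F ⊗[R] I.unionInvPow)
      (inferInstanceAs (Module.Flat R (F ⊗[R] I.unionInvPow))) h'
    have hbij := hcover.2 (k ∘ₗ I.toTensorUnionInvPow F) (by
      rw [← LinearMap.comp_assoc, hk, hh'])
    have hsurj : Function.Surjective k := Function.Surjective.of_comp hbij.2
    have htop : (⊤ : Submodule R (F ⊗[R] I.unionInvPow)).map k = ⊤ := by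
      rw [Submodule.map_top, LinearMap.range_eq_top.2 hsurj]
    rw [← htop, ← Submodule.map_smul'', (hinv I hI).smul_top_tensor_unionInvPow]
  · intro I hI F _ _ hF
    have := (hinv I hI).flat_unionInvPow
    refine ⟨inferInstance, ?_, fun N _ _ hN g =>
      (hinv I hI).exists_comp_toTensorUnionInvPow (hperf I hI) (hN I rfl) g⟩
    rintro J rfl
    exact (hinv J hI).smul_top_tensor_unionInvPow
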